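/- Let $H^2(\mathbb D^2)$ be the Hardy space over the bidisk, with elements identified with their boundary functions in $L^2(\mathbb T^2)$, and let $m$ be normalized Lebesgue measure on $\mathbb T^2$. For a closed subspace $M\subset H^2(\mathbb D^2)$ invariant under multiplication by the coordinate functions $z$ and $w$, let $K^M(\lambda,z)$ be its reproducing kernel, that is, $K^M(\lambda,\cdot)\in M$ and $f(\lambda)=\langle f,K^M(\lambda,\cdot)\rangle$ for $f\in M$. Put $$G^M(\lambda,z)=(1-\overline{\lambda_1}z_1)(1-\overline{\lambda_2}z_2)K^M(\lambda,z),$$ where for $\lambda\in\mathbb T^2$ and $z\in\mathbb D^2$ boundary values in $\lambda$ are taken. The core operator $C^M$ is the bounded operator on $H^2(\mathbb D^2)$ given by $$(C^Mf)(z)=\int_{\mathbb T^2}G^M(\lambda,z)f(\lambda)\,dm(\lambda),\qquad z\in\mathbb D^2.$$ Let $M=[(z-w)^2]$ be the closure of $(z-w)^2\,\mathbb C[z,w]$ in $H^2(\mathbb D^2)$, and let $C=C^M$. Then $C$ is a Hilbert--Schmidt operator, $C^2$ is trace class, and $$\|C\|_{HS}^2=\operatorname{Tr}(C^2)=\tfrac43\pi^2-9.$$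 -/

import Mathlib

open MeasureTheory ComplexConjugate
open scoped Complex.UnitDisc

noncomputable section

namespace Bidisk

/-- Normalized Lebesgue (Haar) measure on the torus `𝕋²`. A point of `𝕋²` is given by the angles
`t 0, t 1 ∈ ℝ/ℤ` of its two coordinates. -/
abbrev torusMeasure : Measure (UnitAddTorus (Fin 2)) :=
  Measure.pi fun _ => AddCircle.haarAddCircle

/-- `L²(𝕋²)`. -/
abbrev L2Torus : Type := Lp ℂ 2 torusMeasure

/-- The orthonormal basis `λ ↦ λ₁^(n 0) λ₂^(n 1)`, `n ∈ ℤ²`, of `L²(𝕋²)`. -/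
def fourierBasis : HilbertBasis (Fin 2 → ℤ) ℂ L2Torus := UnitAddTorus.mFourierBasis

theorem inner_fourierBasis (n : Fin 2 → ℤ) (f : L2Torus) :
    inner ℂ (fourierBasis n) f = UnitAddTorus.mFourierCoeff f n := by
  rw [← HilbertBasis.repr_apply_apply]
  exact UnitAddTorus.mFourierBasis_repr f n

/-- The Hardy space as a subspace of `L²(𝕋²)`: the functions all of whose Fourier coefficients with
a negative index vanish (`mFourierCoeff` integrates against normalized Haar measure). -/
def hardySpace : Submodule ℂ L2Torus where
  carrier := {f | ∀ n : Fin 2 → ℤ, (∃ i, n i < 0) → UnitAddTorus.mFourierCoeff f n = 0}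
  zero_mem' n _ := by rw [← inner_fourierBasis, inner_zero_right]
  add_mem' {f g} hf hg n hn := by
    rw [← inner_fourierBasis, inner_add_right, inner_fourierBasis, inner_fourierBasis, hf n hn,
      hg n hn, add_zero]
  smul_mem' c f hf n hn := by
    rw [← inner_fourierBasis, inner_smul_right, inner_fourierBasis, hf n hn, mul_zero]

theorem isClosed_hardySpace : IsClosed (hardySpace : Set L2Torus) := by
  have : (hardySpace : Set L2Torus) =
      ⋂ n : Fin 2 → ℤ, ⋂ _ : ∃ i, n i < 0, {f | inner ℂ (fourierBasis n) f = 0} := by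
    ext f
    simp only [Set.mem_iInter, Set.mem_ofPred_eq, inner_fourierBasis]
    rfl
  rw [this]
  exact isClosed_iInter fun n => isClosed_iInter fun _ =>
    isClosed_eq (by fun_prop) continuous_const

/-- The Hilbert space `H²(𝔻²)`, with the inner product of `L²(𝕋²)`. Its elements are functions on the
bidisk through the `RKHS` instance below, and they have boundary values through `boundary`. -/
def Hardy : Type := hardySpace

instance : NormedAddCommGroup Hardy := inferInstanceAs (NormedAddCommGroup hardySpace)

instance : InnerProductSpace ℂ Hardy := inferInstanceAs (InnerProductSpace ℂ hardySpace)

instance : CompleteSpace Hardy := isClosed_hardySpace.completeSpace_coe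

/-- The boundary function in `L²(𝕋²)` of an element of `H²(𝔻²)`. -/
def boundary : Hardy →ₗᵢ[ℂ] L2Torus := hardySpace.subtypeₗᵢ

theorem boundary_mem (f : Hardy) : boundary f ∈ hardySpace := f.2

theorem exists_boundary {g : L2Torus} (hg : g ∈ hardySpace) : ∃ f : Hardy, boundary f = g :=
  ⟨⟨g, hg⟩, rfl⟩

/-- The Taylor coefficient of index `n` of `f ∈ H²(𝔻²)`. -/
def taylorCoeff (n : ℕ × ℕ) : Hardy →L[ℂ] ℂ :=
  innerSL ℂ (fourierBasis ![n.1, n.2]) ∘L boundary.toContinuousLinearMap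

theorem taylorCoeff_apply (n : ℕ × ℕ) (f : Hardy) :
    taylorCoeff n f = UnitAddTorus.mFourierCoeff (boundary f) ![n.1, n.2] :=
  inner_fourierBasis _ _

theorem norm_taylorCoeff_le (n : ℕ × ℕ) : ‖taylorCoeff n‖ ≤ 1 := by
  refine ContinuousLinearMap.opNorm_le_bound _ zero_le_one fun f => ?_
  have := norm_inner_le_norm (𝕜 := ℂ) (fourierBasis ![(n.1 : ℤ), n.2]) (boundary f)
  rwa [fourierBasis.orthonormal.1, boundary.norm_map] at this

theorem summable_monomial (z : 𝔻 × 𝔻) :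
    Summable fun n : ℕ × ℕ => ‖(z.1 : ℂ) ^ n.1 * (z.2 : ℂ) ^ n.2‖ := by
  have h (x : 𝔻) : Summable fun n : ℕ => ‖(x : ℂ) ^ n‖ := by
    simpa using summable_geometric_of_lt_one (norm_nonneg _) x.norm_lt_one
  simpa using (h z.1).mul_of_nonneg (h z.2) (fun _ => norm_nonneg _) (fun _ => norm_nonneg _)

theorem summable_eval (z : 𝔻 × 𝔻) :
    Summable fun n : ℕ × ℕ => ((z.1 : ℂ) ^ n.1 * (z.2 : ℂ) ^ n.2) • taylorCoeff n := by
  refine Summable.of_norm_bounded (summable_monomial z) fun n => ?_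
  rw [norm_smul]
  exact mul_le_of_le_one_right (norm_nonneg _) (norm_taylorCoeff_le n)

/-- Evaluation at a point of the bidisk: `f(z, w) = ∑ a_{mn} z^m w^n`. -/
def evalCLM (z : 𝔻 × 𝔻) : Hardy →L[ℂ] ℂ :=
  ∑' n : ℕ × ℕ, ((z.1 : ℂ) ^ n.1 * (z.2 : ℂ) ^ n.2) • taylorCoeff n

theorem hasSum_evalCLM (z : 𝔻 × 𝔻) (f : Hardy) :
    HasSum (fun n : ℕ × ℕ => (z.1 : ℂ) ^ n.1 * (z.2 : ℂ) ^ n.2 * taylorCoeff n f)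
      (evalCLM z f) := by
  simpa [evalCLM] using (ContinuousLinearMap.apply ℂ ℂ f).hasSum (summable_eval z).hasSum

theorem powerSeries_unique (c : ℕ → ℂ)
    (h : ∀ z : 𝔻, HasSum (fun n => (z : ℂ) ^ n * c n) 0) : c = 0 := by
  have hp : HasFPowerSeriesAt (fun _ : ℂ => (0 : ℂ)) (FormalMultilinearSeries.ofScalars ℂ c) 0 := by
    rw [hasFPowerSeriesAt_iff]
    filter_upwards [Metric.ball_mem_nhds (0 : ℂ) one_pos] with z hz
    simpa [FormalMultilinearSeries.coeff_ofScalars] using! h (.mk z (by simpa using hz))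
  exact (FormalMultilinearSeries.ofScalars_series_eq_zero ℂ).1 hp.eq_zero

theorem evalCLM_injective (f : Hardy) (h : ∀ z, evalCLM z f = 0) : f = 0 := by
  have hT : ∀ n, taylorCoeff n f = 0 := by
    have h1 (w : 𝔻) : (fun m => ∑' n : ℕ, (w : ℂ) ^ n * taylorCoeff (m, n) f) = 0 := by
      refine powerSeries_unique _ fun z => ?_
      have h2 := hasSum_evalCLM (z, w) f
      rw [h] at h2
      convert h2.prod_fiberwise fun m => (h2.summable.prod_factor m).hasSum using 2 with m
      simp only [mul_assoc, tsum_mul_left]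
    rintro ⟨m, n⟩
    refine congrFun (powerSeries_unique (fun n => taylorCoeff (m, n) f) fun w => ?_) n
    have h3 : Summable fun n : ℕ => (w : ℂ) ^ n * taylorCoeff (m, n) f := by
      refine Summable.of_norm_bounded (g := fun n => ‖(w : ℂ)‖ ^ n * ‖f‖)
        ((summable_geometric_of_lt_one (norm_nonneg _) w.norm_lt_one).mul_right _) fun n => ?_
      rw [norm_mul, norm_pow]
      gcongr
      simpa using (taylorCoeff (m, n)).le_of_opNorm_le (norm_taylorCoeff_le (m, n)) f
    have h4 := h3.hasSum
    rwa [congrFun (h1 w) m] at h4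
  apply boundary.injective
  rw [map_zero]
  apply fourierBasis.repr.injective
  ext n
  rw [HilbertBasis.repr_apply_apply, inner_fourierBasis]
  by_cases hn : ∃ i, n i < 0
  · rw [boundary_mem f n hn]; simp
  · push Not at hn
    have := hT ((n 0).toNat, (n 1).toNat)
    rw [taylorCoeff_apply] at this
    have e : ![(((n 0).toNat : ℕ) : ℤ), ((n 1).toNat : ℕ)] = n := by
      ext i; fin_cases i <;> simp [hn]
    rw [e] at this
    rw [this]; simp

/-- `H²(𝔻²)` as a reproducing kernel Hilbert space of functions on the bidisk. -/
instance : RKHS ℂ Hardy (𝔻 × 𝔻) ℂ where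
  coeCLM := .pi evalCLM
  coeCLM_injective := (injective_iff_map_eq_zero _).2 fun f hf =>
    evalCLM_injective f fun z => congrFun hf z

/-- A subspace of `H²(𝔻²)` as a space of functions on the bidisk. -/
instance (M : Submodule ℂ Hardy) : RKHS ℂ M (𝔻 × 𝔻) ℂ where
  coeCLM := RKHS.coeCLM ℂ ∘L M.subtypeL
  coeCLM_injective := RKHS.coeCLM_injective.comp Subtype.val_injective

/-- An element of `H²(𝔻²)`, as a function on the bidisk, is the sum of the power series whose
coefficients are the Fourier coefficients of its boundary function. -/
theorem apply_eq_tsum (f : Hardy) (z : 𝔻 × 𝔻) :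
    f z = ∑' n : ℕ × ℕ, UnitAddTorus.mFourierCoeff (boundary f) ![n.1, n.2] *
      (z.1 : ℂ) ^ n.1 * (z.2 : ℂ) ^ n.2 := by
  rw [show f z = evalCLM z f from rfl, ← (hasSum_evalCLM z f).tsum_eq]
  exact tsum_congr fun n => by rw [taylorCoeff_apply]; ring

/-- The coordinate functions `λ₁, λ₂` on `𝕋²`. -/
def coord (j : Fin 2) (t : UnitAddTorus (Fin 2)) : ℂ := AddCircle.toCircle (t j)

theorem coord_eq_mFourier (j : Fin 2) (t : UnitAddTorus (Fin 2)) :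
    coord j t = UnitAddTorus.mFourier (Pi.single j 1) t := by
  rw [UnitAddTorus.mFourier_single, fourier_one, coord]

theorem norm_coord (j : Fin 2) (t : UnitAddTorus (Fin 2)) : ‖coord j t‖ = 1 :=
  Circle.norm_coe _

theorem continuous_coord (j : Fin 2) : Continuous (coord j) := by
  rw [show coord j = UnitAddTorus.mFourier (Pi.single j 1) from funext (coord_eq_mFourier j)]
  exact ContinuousMap.continuous _

theorem memLp_coord_mul (j : Fin 2) (f : L2Torus) :
    MemLp (fun t => coord j t * f t) 2 torusMeasure :=
  (Lp.memLp f).congr_norm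
    ((continuous_coord j).aestronglyMeasurable.mul (Lp.aestronglyMeasurable f))
    (.of_forall fun t => by simp [norm_coord])

/-- Multiplication by a coordinate function on `L²(𝕋²)`. -/
def mulL2 (j : Fin 2) : L2Torus →ₗᵢ[ℂ] L2Torus where
  toFun f := (memLp_coord_mul j f).toLp
  map_add' f g := by
    rw [← MemLp.toLp_add]
    refine MemLp.toLp_congr _ _ ?_
    filter_upwards [Lp.coeFn_add f g] with t ht
    rw [ht, Pi.add_apply, Pi.add_apply, mul_add]
  map_smul' c f := by
    rw [RingHom.id_apply, ← MemLp.toLp_const_smul]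
    refine MemLp.toLp_congr _ _ ?_
    filter_upwards [Lp.coeFn_smul c f] with t ht
    simp only [ht, Pi.smul_apply, smul_eq_mul]
    ring
  norm_map' f := by
    change ‖(memLp_coord_mul j f).toLp‖ = ‖f‖
    rw [Lp.norm_toLp, Lp.norm_def]
    congr 1
    exact eLpNorm_congr_norm_ae (.of_forall fun t => by simp [norm_coord])

theorem coeFn_mulL2 (j : Fin 2) (f : L2Torus) :
    mulL2 j f =ᵐ[torusMeasure] fun t => coord j t * f t :=
  (memLp_coord_mul j f).coeFn_toLp

theorem mFourierCoeff_mulL2 (j : Fin 2) (f : L2Torus) (n : Fin 2 → ℤ) :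
    UnitAddTorus.mFourierCoeff (mulL2 j f) n =
      UnitAddTorus.mFourierCoeff f (n - Pi.single j 1) := by
  refine integral_congr_ae ?_
  filter_upwards [coeFn_mulL2 j f] with t ht
  rw [ht, coord_eq_mFourier, neg_sub, sub_eq_neg_add, UnitAddTorus.mFourier_add]
  simp only [smul_eq_mul]
  ring

theorem mulL2_mem (j : Fin 2) {f : L2Torus} (hf : f ∈ hardySpace) : mulL2 j f ∈ hardySpace := by
  rintro n ⟨i, hi⟩
  rw [mFourierCoeff_mulL2]
  refine hf _ ⟨i, ?_⟩
  have : (0 : ℤ) ≤ (Pi.single j 1 : Fin 2 → ℤ) i := by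
    by_cases h : i = j
    · subst h; simp
    · simp [h]
  simp only [Pi.sub_apply]
  omega

/-- Multiplication by a coordinate function on `H²(𝔻²)`. -/
def mulCoord (j : Fin 2) : Hardy →ₗᵢ[ℂ] Hardy where
  toFun f := ⟨mulL2 j (boundary f), mulL2_mem j (boundary_mem f)⟩
  map_add' f g := boundary.injective (by
    change mulL2 j (boundary (f + g)) = mulL2 j (boundary f) + mulL2 j (boundary g)
    simp)
  map_smul' c f := boundary.injective (by
    change mulL2 j (boundary (c • f)) = c • mulL2 j (boundary f)
    simp)
  norm_map' f := by
    change ‖mulL2 j (boundary f)‖ = ‖f‖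
    simp

theorem boundary_mulCoord (j : Fin 2) (f : Hardy) :
    boundary (mulCoord j f) = mulL2 j (boundary f) := rfl

theorem coeFn_boundary_mulCoord (j : Fin 2) (f : Hardy) :
    boundary (mulCoord j f) =ᵐ[torusMeasure] fun t => coord j t * boundary f t :=
  coeFn_mulL2 j (boundary f)

theorem mulCoord_apply (f : Hardy) (z : 𝔻 × 𝔻) :
    mulCoord 0 f z = z.1 * f z ∧ mulCoord 1 f z = z.2 * f z := by
  constructor
  · have hi : Function.Injective fun n : ℕ × ℕ => (n.1 + 1, n.2) := by
      rintro ⟨a, b⟩ ⟨c, d⟩ h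
      simpa using h
    have h1 := hasSum_evalCLM z (mulCoord 0 f)
    rw [← hi.hasSum_iff] at h1
    · refine h1.unique (((hasSum_evalCLM z f).mul_left (z.1 : ℂ)).congr_fun ?_)
      rintro ⟨a, b⟩
      simp only [Function.comp_apply, taylorCoeff_apply, boundary_mulCoord, mFourierCoeff_mulL2]
      rw [show (![((a + 1 : ℕ) : ℤ), (b : ℤ)] - Pi.single 0 1 : Fin 2 → ℤ) = ![(a : ℤ), b] by
        ext i; fin_cases i <;> simp]
      ring
    · rintro ⟨a, b⟩ hab
      have : a = 0 := by
        by_contra h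
        exact hab ⟨(a - 1, b), by simp; omega⟩
      subst this
      rw [taylorCoeff_apply, boundary_mulCoord, mFourierCoeff_mulL2,
        boundary_mem f _ ⟨0, by simp⟩, mul_zero]
  · have hi : Function.Injective fun n : ℕ × ℕ => (n.1, n.2 + 1) := by
      rintro ⟨a, b⟩ ⟨c, d⟩ h
      simpa using h
    have h1 := hasSum_evalCLM z (mulCoord 1 f)
    rw [← hi.hasSum_iff] at h1
    · refine h1.unique (((hasSum_evalCLM z f).mul_left (z.2 : ℂ)).congr_fun ?_)
      rintro ⟨a, b⟩
      simp only [Function.comp_apply, taylorCoeff_apply, boundary_mulCoord, mFourierCoeff_mulL2]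
      rw [show (![(a : ℤ), ((b + 1 : ℕ) : ℤ)] - Pi.single 1 1 : Fin 2 → ℤ) = ![(a : ℤ), b] by
        ext i; fin_cases i <;> simp]
      ring
    · rintro ⟨a, b⟩ hab
      have : b = 0 := by
        by_contra h
        exact hab ⟨(a, b - 1), by simp; omega⟩
      subst this
      rw [taylorCoeff_apply, boundary_mulCoord, mFourierCoeff_mulL2,
        boundary_mem f _ ⟨1, by simp⟩, mul_zero]

section CoreOperator

variable (M : Submodule ℂ Hardy) [CompleteSpace M]

/-- The function `K^M(z, ·) ∈ M ⊆ H²(𝔻²)`, where `K^M(λ, ·)` denotes the reproducing kernel of `M` at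
`λ`, that is `f(λ) = ⟨f, K^M(λ, ·)⟩` for `f ∈ M` (mathematical convention for the inner product). -/
def kernelAt (z : 𝔻 × 𝔻) : Hardy := (RKHS.kerFun M z 1 : M)

/-- The core function `G^M(λ, z) = (1 - conj λ₁ z₁) (1 - conj λ₂ z₂) K^M(λ, z)` for `λ ∈ 𝕋²` and
`z ∈ 𝔻²`. As `K^M(λ, z) = conj K^M(z, λ)`, the boundary value of `K^M(λ, z)` in the variable `λ` is
the conjugate of the boundary function of `K^M(z, ·) ∈ H²(𝔻²)`. -/
def coreFunction (t : UnitAddTorus (Fin 2)) (z : 𝔻 × 𝔻) : ℂ :=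
  (1 - conj (coord 0 t) * z.1) * (1 - conj (coord 1 t) * z.2) *
    conj (boundary (kernelAt M z) t)

theorem inner_kernelAt (z : 𝔻 × 𝔻) (g : Hardy) :
    inner ℂ (kernelAt M z) g = M.starProjection g z := by
  have h := RKHS.kerFun_inner (𝕜 := ℂ) z (1 : ℂ) (M.orthogonalProjectionOnto g)
  rw [Submodule.inner_orthogonalProjectionOnto_eq_of_mem_left] at h
  refine h.trans ?_
  rw [RCLike.inner_apply, map_one, mul_one]
  rfl

theorem inner_eq_integral (f g : Hardy) :
    inner ℂ f g = ∫ t, conj (boundary f t) * boundary g t ∂torusMeasure := by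
  rw [← boundary.inner_map_map, L2.inner_def]
  refine integral_congr_ae (.of_forall fun t => ?_)
  exact mul_comm _ _

theorem integrable_mul (f g : Hardy) :
    Integrable (fun t => conj (boundary f t) * boundary g t) torusMeasure := by
  refine (L2.integrable_inner (𝕜 := ℂ) (boundary f) (boundary g)).congr (.of_forall fun t => ?_)
  exact mul_comm _ _

theorem integral_coreFunction (f : Hardy) (z : 𝔻 × 𝔻) :
    ∫ t, coreFunction M t z * boundary f t ∂torusMeasure =
      inner ℂ (kernelAt M z) f - z.1 * inner ℂ (mulCoord 0 (kernelAt M z)) f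
        - z.2 * inner ℂ (mulCoord 1 (kernelAt M z)) f
        + z.1 * (z.2 * inner ℂ (mulCoord 0 (mulCoord 1 (kernelAt M z))) f) := by
  set k := kernelAt M z with hk
  have i0 := integrable_mul k f
  have i1 := (integrable_mul (mulCoord 0 k) f).const_mul (z.1 : ℂ)
  have i2 := (integrable_mul (mulCoord 1 k) f).const_mul (z.2 : ℂ)
  have i3 := ((integrable_mul (mulCoord 0 (mulCoord 1 k)) f).const_mul (z.2 : ℂ)).const_mul
    (z.1 : ℂ)
  have key {F0 F1 F2 F3 : UnitAddTorus (Fin 2) → ℂ} (h0 : Integrable F0 torusMeasure)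
      (h1 : Integrable F1 torusMeasure) (h2 : Integrable F2 torusMeasure)
      (h3 : Integrable F3 torusMeasure) :
      ∫ t, (F0 t - F1 t - F2 t + F3 t) ∂torusMeasure =
        ∫ t, F0 t ∂torusMeasure - ∫ t, F1 t ∂torusMeasure - ∫ t, F2 t ∂torusMeasure
          + ∫ t, F3 t ∂torusMeasure := by
    rw [← integral_sub h0 h1]
    refine (integral_add ((h0.sub h1).sub h2) h3).trans ?_
    exact congrArg (· + _) (integral_sub (h0.sub h1) h2)
  simp only [inner_eq_integral, ← integral_const_mul]
  rw [← key i0 i1 i2 i3]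
  refine integral_congr_ae ?_
  filter_upwards [coeFn_boundary_mulCoord 0 k, coeFn_boundary_mulCoord 1 k,
    coeFn_boundary_mulCoord 0 (mulCoord 1 k)] with t h0 h1 h2
  simp only [coreFunction, ← hk]
  rw [h2, h0, h1]
  simp only [map_mul]
  ring

theorem exists_coreOperator :
    ∃ C : Hardy →L[ℂ] Hardy, ∀ (f : Hardy) (z : 𝔻 × 𝔻),
      C f z = ∫ t, coreFunction M t z * boundary f t ∂torusMeasure := by
  let P := M.starProjection
  let S (j : Fin 2) : Hardy →L[ℂ] Hardy := (mulCoord j).toContinuousLinearMap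
  refine ⟨P - S 0 ∘L P ∘L (S 0).adjoint - S 1 ∘L P ∘L (S 1).adjoint +
    S 0 ∘L S 1 ∘L P ∘L (S 1).adjoint ∘L (S 0).adjoint, fun f z => ?_⟩
  have hS (j : Fin 2) (g h : Hardy) : inner ℂ (mulCoord j g) h = inner ℂ g ((S j).adjoint h) :=
    (ContinuousLinearMap.adjoint_inner_right (S j) g h).symm
  rw [integral_coreFunction, hS, hS, hS, hS, inner_kernelAt, inner_kernelAt, inner_kernelAt,
    inner_kernelAt, ← (mulCoord_apply _ z).1, ← (mulCoord_apply _ z).2, ← (mulCoord_apply _ z).2,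
    ← (mulCoord_apply _ z).1]
  have hadd (a b : Hardy) : (a + b) z = a z + b z := map_add (evalCLM z) a b
  have hsub (a b : Hardy) : (a - b) z = a z - b z := map_sub (evalCLM z) a b
  rw [← hsub, ← hsub, ← hadd]
  rfl

/-- The core operator, i.e. the bounded operator on `H²(𝔻²)` with
`(C f)(z) = ∫ G^M(λ, z) f(λ) dm(λ)` for `z ∈ 𝔻²`. It is determined by this formula. -/
def coreOperator : Hardy →L[ℂ] Hardy := (exists_coreOperator M).choose

theorem coreOperator_apply (f : Hardy) (z : 𝔻 × 𝔻) :
    coreOperator M f z = ∫ t, coreFunction M t z * boundary f t ∂torusMeasure :=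
  (exists_coreOperator M).choose_spec f z

theorem eq_coreOperator {C : Hardy →L[ℂ] Hardy}
    (hC : ∀ f z, C f z = ∫ t, coreFunction M t z * boundary f t ∂torusMeasure) :
    C = coreOperator M :=
  ContinuousLinearMap.ext fun f => RKHS.ext fun z => by rw [hC, coreOperator_apply]

end CoreOperator

/-- A polynomial as a function on `𝕋²`. -/
def polynomialOnTorus (p : MvPolynomial (Fin 2) ℂ) : C(UnitAddTorus (Fin 2), ℂ) where
  toFun t := MvPolynomial.eval (fun j => coord j t) p
  continuous_toFun := (MvPolynomial.continuous_eval p).comp (continuous_pi continuous_coord)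

/-- A polynomial as an element of `L²(𝕋²)`. -/
def polynomialL2 (p : MvPolynomial (Fin 2) ℂ) : L2Torus :=
  ContinuousMap.toLp 2 torusMeasure ℂ (polynomialOnTorus p)

theorem coeFn_polynomialL2 (p : MvPolynomial (Fin 2) ℂ) :
    polynomialL2 p =ᵐ[torusMeasure] fun t => MvPolynomial.eval (fun j => coord j t) p :=
  ContinuousMap.coeFn_toLp _ _

theorem polynomialL2_add (p q : MvPolynomial (Fin 2) ℂ) :
    polynomialL2 (p + q) = polynomialL2 p + polynomialL2 q := by
  rw [polynomialL2, polynomialL2, polynomialL2, ← map_add]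
  congr 1
  ext t
  simp [polynomialOnTorus]

theorem polynomialL2_C_mul (c : ℂ) (p : MvPolynomial (Fin 2) ℂ) :
    polynomialL2 (MvPolynomial.C c * p) = c • polynomialL2 p := by
  rw [polynomialL2, polynomialL2, ← map_smul]
  congr 1
  ext t
  simp [polynomialOnTorus]

theorem polynomialL2_mul_X (p : MvPolynomial (Fin 2) ℂ) (j : Fin 2) :
    polynomialL2 (p * MvPolynomial.X j) = mulL2 j (polynomialL2 p) := by
  refine Lp.ext ?_
  filter_upwards [coeFn_polynomialL2 (p * MvPolynomial.X j), coeFn_polynomialL2 p,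
    coeFn_mulL2 j (polynomialL2 p)] with t h1 h2 h3
  rw [h1, h3, h2, map_mul, MvPolynomial.eval_X, mul_comm]

theorem polynomialL2_one : polynomialL2 1 = fourierBasis 0 := by
  have h : fourierBasis 0 = ContinuousMap.toLp 2 torusMeasure ℂ (UnitAddTorus.mFourier 0) :=
    congrFun UnitAddTorus.coe_mFourierBasis 0
  rw [h, polynomialL2, UnitAddTorus.mFourier_zero]
  congr 1
  ext t
  simp [polynomialOnTorus]

theorem polynomialL2_mem (p : MvPolynomial (Fin 2) ℂ) : polynomialL2 p ∈ hardySpace := by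
  induction p using MvPolynomial.induction_on with
  | C c =>
    rw [← mul_one (MvPolynomial.C c), polynomialL2_C_mul, polynomialL2_one]
    refine hardySpace.smul_mem c ?_
    rintro n ⟨i, hi⟩
    rw [← inner_fourierBasis]
    refine fourierBasis.orthonormal.2 ?_
    rintro rfl
    simp at hi
  | add p q hp hq =>
    rw [polynomialL2_add]
    exact hardySpace.add_mem hp hq
  | mul_X p j hp =>
    rw [polynomialL2_mul_X]
    exact mulL2_mem j hp

/-- A polynomial as an element of `H²(𝔻²)`. -/
def ofPolynomial : MvPolynomial (Fin 2) ℂ →ₗ[ℂ] Hardy where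
  toFun p := ⟨polynomialL2 p, polynomialL2_mem p⟩
  map_add' p q := boundary.injective (polynomialL2_add p q)
  map_smul' c p := boundary.injective (by
    rw [MvPolynomial.smul_eq_C_mul]
    exact polynomialL2_C_mul c p)

theorem ofPolynomial_mul_X (p : MvPolynomial (Fin 2) ℂ) (j : Fin 2) :
    ofPolynomial (p * MvPolynomial.X j) = mulCoord j (ofPolynomial p) :=
  boundary.injective (polynomialL2_mul_X p j)

/-- The submodule `[p]` of `H²(𝔻²)` generated by a polynomial `p`: the closure of `p ℂ[z, w]`. -/
def polynomialSubmodule (p : MvPolynomial (Fin 2) ℂ) : Submodule ℂ Hardy :=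
  (((Ideal.span {p}).restrictScalars ℂ).map ofPolynomial).topologicalClosure

instance (p : MvPolynomial (Fin 2) ℂ) : CompleteSpace (polynomialSubmodule p) :=
  (Submodule.isClosed_topologicalClosure _).completeSpace_coe

/-- `[p]` is the smallest closed subspace of `H²(𝔻²)` that is invariant under multiplication by the
coordinate functions and contains `p`. -/
theorem isLeast_polynomialSubmodule (p : MvPolynomial (Fin 2) ℂ) :
    IsLeast {M : Submodule ℂ Hardy | IsClosed (M : Set Hardy) ∧
      (∀ j, ∀ f ∈ M, mulCoord j f ∈ M) ∧ ofPolynomial p ∈ M} (polynomialSubmodule p) := by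
  refine ⟨⟨Submodule.isClosed_topologicalClosure _, fun j f hf => ?_, ?_⟩, ?_⟩
  · refine map_mem_closure (mulCoord j).continuous hf ?_
    rintro _ ⟨q, hq, rfl⟩
    exact ⟨q * MvPolynomial.X j, Ideal.mul_mem_right _ _ hq, ofPolynomial_mul_X q j⟩
  · exact subset_closure ⟨p, Ideal.subset_span rfl, rfl⟩
  · rintro M ⟨hM, hinv, hp⟩
    refine Submodule.topologicalClosure_minimal _ ?_ hM
    rintro _ ⟨q, hq, rfl⟩
    obtain ⟨r, rfl⟩ := Ideal.mem_span_singleton.1 hq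
    induction r using MvPolynomial.induction_on with
    | C c =>
      rw [mul_comm, ← MvPolynomial.smul_eq_C_mul, map_smul]
      exact M.smul_mem c hp
    | add r s hr hs =>
      rw [mul_add, map_add]
      exact M.add_mem (hr (Ideal.mem_span_singleton.2 ⟨r, rfl⟩))
        (hs (Ideal.mem_span_singleton.2 ⟨s, rfl⟩))
    | mul_X r j hr =>
      rw [← mul_assoc, ofPolynomial_mul_X]
      exact hinv j _ (hr (Ideal.mem_span_singleton.2 ⟨r, rfl⟩))

section Operators

variable {E : Type} [NormedAddCommGroup E] [InnerProductSpace ℂ E]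

/-- `T` is a Hilbert-Schmidt operator with `‖T‖²_HS = s`: for every orthonormal basis `e`,
`∑ ‖T eᵢ‖²` converges to `s`. -/
def HasHilbertSchmidtNormSq (T : E →L[ℂ] E) (s : ℝ) : Prop :=
  ∀ (ι : Type) (e : HilbertBasis ι ℂ E), HasSum (fun i => ‖T (e i)‖ ^ 2) s

/-- `T` is trace class: it is a product of two Hilbert-Schmidt operators. -/
def IsTraceClass (T : E →L[ℂ] E) : Prop :=
  ∃ (A B : E →L[ℂ] E) (a b : ℝ),
    HasHilbertSchmidtNormSq A a ∧ HasHilbertSchmidtNormSq B b ∧ T = A ∘L B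

/-- `T` is trace class with trace `τ`: for every orthonormal basis `e`, `∑ ⟨T eᵢ, eᵢ⟩` converges
to `τ`. -/
def HasTrace (T : E →L[ℂ] E) (τ : ℂ) : Prop :=
  IsTraceClass T ∧
    ∀ (ι : Type) (e : HilbertBasis ι ℂ E), HasSum (fun i => inner ℂ (e i) (T (e i))) τ

end Operators

end Bidisk

end

/-!
The submodule `[(z - w)²]` is graded by degree. In degree `n`, a homogeneous polynomial with
coefficients `c_a` (at `z^a w^(n-a)`) is orthogonal to it iff the second differences of `c` vanish,
that is, iff `c` is affine in `a` (`mem_orthogonal_diagSq`, `affine_of_second_diff`). Hence the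
projection `P` onto `[(z - w)²]` is `1 - affineProj n` in degree `n` (`starProjection_mono`), with
`affineProj n a b = 1 / (n + 1) + 12 x y / (n (n + 1) (n + 2))`, `x = a - n / 2`, `y = b - n / 2`.

The core operator is `C = P - S₀ P S₀* - S₁ P S₁* + S₀ S₁ P S₁* S₀*` with `S₀`, `S₁` the shifts
(`inner_coreOperator`). It is symmetric, and `inner_mono_coreOperator` gives its matrix in the basis
of monomials, which is block diagonal. The blocks of degrees `0` and `1` vanish, the sum of the
squared entries is `1` in degree `2` and `8 / n²` in degree `n ≥ 3` (`sum_coreCoeff_sq`), and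
`1 + 8 (π² / 6 - 1 - 1 / 4) = 4 / 3 π² - 9`.

As `C` is symmetric, `∑ ‖C eᵢ‖²` is the same for all orthonormal bases
(`hasHilbertSchmidtNormSq_of_hasSum`), and `⟨C² eᵢ, eᵢ⟩ = ‖C eᵢ‖²` gives the trace.
-/

noncomputable section

namespace Bidisk

/-! ### Hilbert–Schmidt norms of symmetric operators -/

section HilbertSchmidt

variable {E : Type} [NormedAddCommGroup E] [InnerProductSpace ℂ E]

theorem hasSum_norm_inner_sq {ι : Type*} (e : HilbertBasis ι ℂ E) (x : E) :
    HasSum (fun i => ‖inner ℂ (e i) x‖ ^ 2) (‖x‖ ^ 2) := by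
  have h := Complex.hasSum_re (e.hasSum_inner_mul_inner x x)
  convert h using 1
  · ext i
    rw [← inner_conj_symm x (e i), ← Complex.normSq_eq_conj_mul_self, Complex.ofReal_re,
      Complex.normSq_eq_norm_sq]
  · rw [inner_self_eq_norm_sq_to_K]
    norm_cast

/-- For a symmetric operator the sum `∑ ‖T eᵢ‖²` does not depend on the orthonormal basis, as
`∑ᵢ ‖T eᵢ‖² = ∑ᵢ ∑ⱼ |⟨fⱼ, T eᵢ⟩|² = ∑ⱼ ∑ᵢ |⟨T fⱼ, eᵢ⟩|²`. -/
theorem hasHilbertSchmidtNormSq_of_hasSum {T : E →L[ℂ] E}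
    (hT : ∀ x y, inner ℂ (T x) y = inner ℂ x (T y)) {κ : Type*} (f : HilbertBasis κ ℂ E) {s : ℝ}
    (hs : HasSum (fun j => ‖T (f j)‖ ^ 2) s) : HasHilbertSchmidtNormSq T s := by
  intro ι e
  have hrow (j : κ) : HasSum (fun i => ‖inner ℂ (e i) (T (f j))‖ ^ 2) (‖T (f j)‖ ^ 2) :=
    hasSum_norm_inner_sq e _
  have hsum : Summable fun p : κ × ι => ‖inner ℂ (e p.2) (T (f p.1))‖ ^ 2 := by
    refine (summable_prod_of_nonneg fun p => sq_nonneg _).2 ⟨fun j => (hrow j).summable, ?_⟩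
    exact hs.summable.congr fun j => (hrow j).tsum_eq.symm
  have htot : HasSum (fun p : κ × ι => ‖inner ℂ (e p.2) (T (f p.1))‖ ^ 2) s := by
    have h := hsum.hasSum
    rwa [(h.prod_fiberwise hrow).unique hs] at h
  refine HasSum.prod_fiberwise ((Equiv.prodComm ι κ).hasSum_iff.2 htot) fun i => ?_
  refine (hasSum_norm_inner_sq f (T (e i))).congr_fun fun j => ?_
  change ‖inner ℂ (e i) (T (f j))‖ ^ 2 = _
  rw [← hT, norm_inner_symm]

theorem HasHilbertSchmidtNormSq.hasTrace_comp_self {T : E →L[ℂ] E}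
    (hT : ∀ x y, inner ℂ (T x) y = inner ℂ x (T y)) {s : ℝ} (hs : HasHilbertSchmidtNormSq T s) :
    HasTrace (T ∘L T) (s : ℂ) := by
  refine ⟨⟨T, T, s, s, hs, hs, rfl⟩, fun ι e => ?_⟩
  refine (Complex.hasSum_ofReal.2 (hs ι e)).congr_fun fun i => ?_
  rw [ContinuousLinearMap.comp_apply, ← hT, inner_self_eq_norm_sq_to_K]
  norm_cast

end HilbertSchmidt

/-! ### Projection onto affine sequences -/

/-- The matrix of the orthogonal projection of `ℂ^{n+1}` onto the affine sequences: in the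
centered variable `x = a - n / 2` these are spanned by the orthogonal vectors `1` and `x`, of
squared norms `n + 1` and `n (n + 1) (n + 2) / 12`. For `n = 0` the second vector is zero, and so
is the second term. -/
def affineProj (n a b : ℕ) : ℝ :=
  1 / (n + 1) + (a - n / 2) * (b - n / 2) * (12 / (n * (n + 1) * (n + 2)))

theorem sum_sub_half (n : ℕ) : ∑ a ∈ Finset.range (n + 1), ((a : ℝ) - n / 2) = 0 := by
  have h (m : ℕ) (c : ℝ) : ∑ a ∈ Finset.range m, ((a : ℝ) - c) = m * (m - 1) / 2 - m * c := by
    induction m with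
    | zero => simp
    | succ m ih => rw [Finset.sum_range_succ, ih]; push_cast; ring
  rw [h]; push_cast; ring

theorem sum_sub_half_sq (n : ℕ) :
    ∑ a ∈ Finset.range (n + 1), ((a : ℝ) - n / 2) ^ 2 = (n : ℝ) * (n + 1) * (n + 2) / 12 := by
  have h (m : ℕ) (c : ℝ) : ∑ a ∈ Finset.range m, ((a : ℝ) - c) ^ 2 =
      (m : ℝ) * (m - 1) * (2 * m - 1) / 6 - c * m * (m - 1) + m * c ^ 2 := by
    induction m with
    | zero => simp
    | succ m ih => rw [Finset.sum_range_succ, ih]; push_cast; ring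
  rw [h]; push_cast; ring

theorem sum_affine_sq (n : ℕ) (u v : ℝ) :
    ∑ a ∈ Finset.range (n + 1), (u + v * ((a : ℝ) - n / 2)) ^ 2 =
      (n + 1) * u ^ 2 + v ^ 2 * (n * (n + 1) * (n + 2) / 12) := by
  have h (a : ℕ) : (u + v * ((a : ℝ) - n / 2)) ^ 2 =
      u ^ 2 + 2 * u * v * ((a : ℝ) - n / 2) + v ^ 2 * ((a : ℝ) - n / 2) ^ 2 := by ring
  simp only [h, Finset.sum_add_distrib, ← Finset.mul_sum, sum_sub_half, sum_sub_half_sq]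
  simp

/-- `affineProj n` fixes affine sequences. -/
theorem sum_affineProj_mul (n a : ℕ) (ha : a ≤ n) (A B : ℂ) :
    ∑ b ∈ Finset.range (n + 1), (affineProj n a b : ℂ) * (A + B * b) = A + B * a := by
  have h1 : ∑ b ∈ Finset.range (n + 1), ((b : ℂ) - n / 2) = 0 := by
    simpa using congrArg (fun x : ℝ => (x : ℂ)) (sum_sub_half n)
  have h2 : ∑ b ∈ Finset.range (n + 1), ((b : ℂ) - n / 2) ^ 2 =
      (n : ℂ) * (n + 1) * (n + 2) / 12 := by
    simpa using congrArg (fun x : ℝ => (x : ℂ)) (sum_sub_half_sq n)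
  have hn1 : (n + 1 : ℂ) ≠ 0 := by exact_mod_cast n.succ_ne_zero
  have hn2 : (n + 2 : ℂ) ≠ 0 := by exact_mod_cast (n + 1).succ_ne_zero
  set k : ℂ := 12 / (n * (n + 1) * (n + 2)) with hk
  have hsplit (b : ℕ) : (affineProj n a b : ℂ) * (A + B * b) =
      (A + B * (n / 2)) / (n + 1)
      + (B / (n + 1) + (a - n / 2) * k * (A + B * (n / 2))) * ((b : ℂ) - n / 2)
      + (a - n / 2) * k * B * ((b : ℂ) - n / 2) ^ 2 := by
    simp only [affineProj]
    push_cast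
    rw [← hk]
    ring
  simp only [hsplit, Finset.sum_add_distrib, ← Finset.mul_sum, h1, h2]
  rcases Nat.eq_zero_or_pos n with rfl | hn
  · obtain rfl : a = 0 := by omega
    simp
  · have hn0 : (n : ℂ) ≠ 0 := by exact_mod_cast hn.ne'
    simp only [Finset.sum_const, Finset.card_range, nsmul_eq_mul, hk]
    push_cast
    field_simp
    ring

/-! ### The matrix of the core operator -/

/-- The matrix, in degree `n`, of the projection onto `[(z - w)²]`. -/
def projCoeff (n a b : ℕ) : ℝ := (if a = b then 1 else 0) - affineProj n a b

/-- The matrix, in degree `n`, of the core operator of `[(z - w)²]`; the index `a` stands for the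
monomial `z^a w^(n-a)`. -/
def coreCoeff (n a b : ℕ) : ℝ :=
  projCoeff n a b
    - (if 1 ≤ a ∧ 1 ≤ b then projCoeff (n - 1) (a - 1) (b - 1) else 0)
    - (if a < n ∧ b < n then projCoeff (n - 1) a b else 0)
    + (if (1 ≤ a ∧ 1 ≤ b) ∧ a < n ∧ b < n then projCoeff (n - 2) (a - 1) (b - 1) else 0)

section Entries

variable (m : ℕ)

/-- Away from the border the entries are the negated mixed differences of `affineProj`. With
`x = k - m / 2` and `y = l - m / 2` they have the form `α + β x y`. For `m = 0` both `x` and `y`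
vanish, so that the division by `m` is harmless. -/
theorem coreCoeff_inner {k l : ℕ} (hk : k < m + 1) (hl : l < m + 1) :
    coreCoeff (m + 2) (k + 1) (l + 1) = 4 / ((m + 1) * (m + 2) * (m + 3)) +
      (-(12 / ((m + 1) * (m + 2) * (m + 3)) * (12 / (m * (m + 4)))) * ((k : ℝ) - m / 2)) *
        ((l : ℝ) - m / 2) := by
  have h1 : m + 2 - 1 = m + 1 := rfl
  simp only [coreCoeff, projCoeff, affineProj, h1, Nat.add_sub_cancel, add_left_inj]
  generalize (if k = l then (1 : ℝ) else 0) = δ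
  rw [if_pos (by omega), if_pos (by omega), if_pos (by omega)]
  rcases Nat.eq_zero_or_pos m with rfl | hm
  · obtain rfl : k = 0 := by omega
    obtain rfl : l = 0 := by omega
    norm_num
  · have : (m : ℝ) ≠ 0 := by exact_mod_cast hm.ne'
    push_cast
    field_simp
    ring

theorem coreCoeff_left {l : ℕ} (hl : l < m + 1) :
    coreCoeff (m + 2) 0 (l + 1) = -(2 / ((m + 2) * (m + 3))) +
      (-(12 / ((m + 2) * (m + 3) * (m + 4)))) * ((l : ℝ) - m / 2) := by
  have h1 : m + 2 - 1 = m + 1 := rfl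
  simp only [coreCoeff, projCoeff, affineProj, h1]
  rw [if_neg (by omega), if_neg (by omega), if_pos (by omega), if_neg (by omega)]
  push_cast
  field_simp
  ring

theorem coreCoeff_right {l : ℕ} (hl : l < m + 1) :
    coreCoeff (m + 2) (m + 2) (l + 1) = -(2 / ((m + 2) * (m + 3))) +
      (12 / ((m + 2) * (m + 3) * (m + 4))) * ((l : ℝ) - m / 2) := by
  have h1 : m + 2 - 1 = m + 1 := rfl
  simp only [coreCoeff, projCoeff, affineProj, h1, Nat.add_sub_cancel]
  rw [if_neg (by omega), if_pos (by omega), if_neg (by omega), if_neg (by omega),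
    if_neg (by omega)]
  push_cast
  field_simp
  ring

theorem coreCoeff_symm (n a b : ℕ) : coreCoeff n a b = coreCoeff n b a := by
  have h (n a b : ℕ) : projCoeff n a b = projCoeff n b a := by
    simp only [projCoeff, affineProj, eq_comm (a := a) (b := b)]
    ring
  simp only [coreCoeff, h _ a b, h _ (a - 1) (b - 1), and_comm (a := 1 ≤ a),
    and_comm (a := a < n)]

theorem coreCoeff_corner :
    coreCoeff (m + 2) 0 0 = 4 * (m + 1) / ((m + 2) * (m + 3) * (m + 4)) ∧
    coreCoeff (m + 2) (m + 2) (m + 2) = 4 * (m + 1) / ((m + 2) * (m + 3) * (m + 4)) ∧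
    coreCoeff (m + 2) 0 (m + 2) = 2 * (m + 1) / ((m + 3) * (m + 4)) := by
  have h1 : m + 2 - 1 = m + 1 := rfl
  refine ⟨?_, ?_, ?_⟩ <;> simp [coreCoeff, projCoeff, affineProj, h1] <;> field_simp <;> ring

/-- The squared Hilbert–Schmidt norm of the block of degree `n = m + 2` is `8 / n²` for `n ≥ 3`. The
value for `n = 2` is exceptional, as in degree `n - 2 = 0` the affine sequences have dimension one
instead of two. -/
theorem sum_coreCoeff_sq :
    ∑ a ∈ Finset.range (m + 3), ∑ b ∈ Finset.range (m + 3), coreCoeff (m + 2) a b ^ 2 =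
      if m = 0 then 1 else 8 / (m + 2 : ℝ) ^ 2 := by
  obtain ⟨c1, c2, c3⟩ := coreCoeff_corner m
  -- The entries are affine in each index away from the first and the last row and column.
  have hsplit (f : ℕ → ℝ) : ∑ a ∈ Finset.range (m + 3), f a =
      ∑ k ∈ Finset.range (m + 1), f (k + 1) + f 0 + f (m + 2) := by
    rw [Finset.sum_range_succ, Finset.sum_range_succ']
  have hl : ∑ l ∈ Finset.range (m + 1), coreCoeff (m + 2) 0 (l + 1) ^ 2 =
      (m + 1) * (-(2 / ((m + 2) * (m + 3)))) ^ 2 +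
      (-(12 / ((m + 2) * (m + 3) * (m + 4) : ℝ))) ^ 2 * (m * (m + 1) * (m + 2) / 12) := by
    rw [← sum_affine_sq]
    exact Finset.sum_congr rfl fun l h => by rw [coreCoeff_left m (Finset.mem_range.1 h)]
  have hr : ∑ l ∈ Finset.range (m + 1), coreCoeff (m + 2) (m + 2) (l + 1) ^ 2 =
      (m + 1) * (-(2 / ((m + 2) * (m + 3)))) ^ 2 +
      (12 / ((m + 2) * (m + 3) * (m + 4) : ℝ)) ^ 2 * (m * (m + 1) * (m + 2) / 12) := by
    rw [← sum_affine_sq]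
    exact Finset.sum_congr rfl fun l h => by rw [coreCoeff_right m (Finset.mem_range.1 h)]
  have hi (k : ℕ) (hk : k ∈ Finset.range (m + 1)) :
      ∑ l ∈ Finset.range (m + 1), coreCoeff (m + 2) (k + 1) (l + 1) ^ 2 =
      (m + 1) * (4 / ((m + 1) * (m + 2) * (m + 3) : ℝ)) ^ 2 +
      (12 / ((m + 1) * (m + 2) * (m + 3)) * (12 / (m * (m + 4)))) ^ 2 *
        (m * (m + 1) * (m + 2) / 12) * ((k : ℝ) - m / 2) ^ 2 := by
    rw [Finset.sum_congr rfl fun l h => by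
      rw [coreCoeff_inner m (Finset.mem_range.1 hk) (Finset.mem_range.1 h)], sum_affine_sq]
    ring
  simp only [hsplit, Finset.sum_add_distrib]
  rw [Finset.sum_congr rfl hi]
  simp only [coreCoeff_symm _ (_ + 1) 0, coreCoeff_symm _ (_ + 1) (m + 2),
    hl, hr, c1, c2, c3, Finset.sum_add_distrib, ← Finset.mul_sum,
    sum_sub_half_sq, Finset.sum_const, Finset.card_range, nsmul_eq_mul]
  split_ifs with hm
  · subst hm
    norm_num
  · have : (m : ℝ) ≠ 0 := by exact_mod_cast hm
    push_cast
    field_simp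
    ring

end Entries

theorem hasSum_sum_coreCoeff_sq :
    HasSum (fun n => ∑ a ∈ Finset.range (n + 1), ∑ b ∈ Finset.range (n + 1), coreCoeff n a b ^ 2)
      (4 / 3 * Real.pi ^ 2 - 9) := by
  have hz := hasSum_zeta_two.mul_left 8
  rw [show 8 * (Real.pi ^ 2 / 6) = 4 / 3 * Real.pi ^ 2 - 10 +
    ∑ n ∈ Finset.range 3, 8 * (1 / (n : ℝ) ^ 2) by simp [Finset.sum_range_succ]; ring,
    ← hasSum_nat_add_iff] at hz
  have h : HasSum (fun m => ∑ a ∈ Finset.range (m + 3 + 1), ∑ b ∈ Finset.range (m + 3 + 1),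
      coreCoeff (m + 3) a b ^ 2) (4 / 3 * Real.pi ^ 2 - 10) := by
    refine hz.congr_fun fun m => (sum_coreCoeff_sq (m + 1)).trans ?_
    rw [if_neg m.succ_ne_zero]
    push_cast
    ring
  rw [hasSum_nat_add_iff (f := fun n => ∑ a ∈ Finset.range (n + 1),
    ∑ b ∈ Finset.range (n + 1), coreCoeff n a b ^ 2)] at h
  have e : 4 / 3 * Real.pi ^ 2 - 9 = 4 / 3 * Real.pi ^ 2 - 10 + ∑ n ∈ Finset.range 3,
      ∑ a ∈ Finset.range (n + 1), ∑ b ∈ Finset.range (n + 1), coreCoeff n a b ^ 2 := by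
    rw [Finset.sum_range_succ, sum_coreCoeff_sq 0]
    norm_num [Finset.sum_range_succ, coreCoeff, projCoeff, affineProj]
    ring
  rwa [e]

/-! ### The monomial basis of the Hardy space -/

/-- The monomial `z^a w^b` as an element of `H²(𝔻²)`, for `n = (a, b)`. -/
def mono (n : ℕ × ℕ) : Hardy :=
  ⟨fourierBasis ![n.1, n.2], by
    rintro k ⟨i, hi⟩
    rw [← inner_fourierBasis]
    refine fourierBasis.orthonormal.2 ?_
    rintro rfl
    fin_cases i <;> simp at hi <;> omega⟩

theorem inner_mono (n : ℕ × ℕ) (f : Hardy) : inner ℂ (mono n) f = taylorCoeff n f := rfl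

theorem orthonormal_mono : Orthonormal ℂ mono := by
  have hi : Function.Injective fun n : ℕ × ℕ => ![(n.1 : ℤ), n.2] := by
    rintro ⟨a, b⟩ ⟨c, d⟩ h
    have h0 := congrFun h 0
    have h1 := congrFun h 1
    simp at h0 h1
    simp [h0, h1]
  have h := fourierBasis.orthonormal.comp _ hi
  exact ⟨fun n => h.1 n, fun m n hmn => h.2 hmn⟩

theorem taylorCoeff_mono (m n : ℕ × ℕ) : taylorCoeff m (mono n) = if m = n then 1 else 0 := by
  rw [← inner_mono, orthonormal_iff_ite.1 orthonormal_mono]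

theorem ext_taylorCoeff {f g : Hardy} (h : ∀ n, taylorCoeff n f = taylorCoeff n g) : f = g := by
  rw [← sub_eq_zero]
  refine evalCLM_injective _ fun z => ?_
  refine (hasSum_evalCLM z _).unique ?_
  simp [h, hasSum_zero]

/-- The monomials as an orthonormal basis of `H²(𝔻²)`. -/
def monoBasis : HilbertBasis (ℕ × ℕ) ℂ Hardy :=
  HilbertBasis.mkOfOrthogonalEqBot orthonormal_mono <| (Submodule.eq_bot_iff _).2 fun f hf =>
    ext_taylorCoeff fun n => by
      rw [map_zero, ← inner_mono]
      exact hf _ (Submodule.subset_span ⟨n, rfl⟩)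

theorem monoBasis_apply (n : ℕ × ℕ) : monoBasis n = mono n :=
  congrFun (HilbertBasis.coe_mkOfOrthogonalEqBot _ _) n

theorem mulCoord_zero_mono (a b : ℕ) : mulCoord 0 (mono (a, b)) = mono (a + 1, b) := by
  apply ext_taylorCoeff
  rintro ⟨c, d⟩
  rw [taylorCoeff_apply, boundary_mulCoord, mFourierCoeff_mulL2, taylorCoeff_mono,
    ← inner_fourierBasis]
  change inner ℂ (fourierBasis _) (fourierBasis _) = _
  rw [orthonormal_iff_ite.1 fourierBasis.orthonormal]
  refine if_congr ?_ rfl rfl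
  simp only [funext_iff, Fin.forall_fin_two, Prod.mk.injEq]
  simp
  omega

theorem mulCoord_one_mono (a b : ℕ) : mulCoord 1 (mono (a, b)) = mono (a, b + 1) := by
  apply ext_taylorCoeff
  rintro ⟨c, d⟩
  rw [taylorCoeff_apply, boundary_mulCoord, mFourierCoeff_mulL2, taylorCoeff_mono,
    ← inner_fourierBasis]
  change inner ℂ (fourierBasis _) (fourierBasis _) = _
  rw [orthonormal_iff_ite.1 fourierBasis.orthonormal]
  refine if_congr ?_ rfl rfl
  simp only [funext_iff, Fin.forall_fin_two, Prod.mk.injEq]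
  simp
  omega

theorem ofPolynomial_monomial (a b : ℕ) :
    ofPolynomial (MvPolynomial.X 0 ^ a * MvPolynomial.X 1 ^ b) = mono (a, b) := by
  induction b with
  | zero =>
    induction a with
    | zero =>
      refine boundary.injective ?_
      have h : boundary (mono (0, 0)) = fourierBasis 0 :=
        congrArg fourierBasis (by ext i; fin_cases i <;> simp)
      rw [h, ← polynomialL2_one]
      simp
      rfl
    | succ a ih =>
      rw [pow_zero, mul_one] at ih ⊢
      rw [pow_succ, ofPolynomial_mul_X, ih, mulCoord_zero_mono]
  | succ b ih => rw [pow_succ, ← mul_assoc, ofPolynomial_mul_X, ih, mulCoord_one_mono]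

/-! ### The projection onto `[(z - w)²]` -/

/-- The submodule `[(z - w)²]`. -/
abbrev diagSq : Submodule ℂ Hardy :=
  polynomialSubmodule ((MvPolynomial.X 0 - MvPolynomial.X 1) ^ 2)

/-- A function is orthogonal to `[(z - w)²]` iff its Taylor coefficients, along each antidiagonal,
have vanishing second differences. -/
theorem mem_orthogonal_diagSq {f : Hardy} :
    f ∈ diagSqᗮ ↔ ∀ a b, taylorCoeff (a + 2, b) f - 2 * taylorCoeff (a + 1, b + 1) f +
      taylorCoeff (a, b + 2) f = 0 := by
  have key (a b : ℕ) : inner ℂ (ofPolynomial ((MvPolynomial.X 0 - MvPolynomial.X 1) ^ 2 *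
      (MvPolynomial.X 0 ^ a * MvPolynomial.X 1 ^ b))) f =
      taylorCoeff (a + 2, b) f - 2 * taylorCoeff (a + 1, b + 1) f + taylorCoeff (a, b + 2) f := by
    have h : ((MvPolynomial.X 0 - MvPolynomial.X 1) ^ 2 *
        (MvPolynomial.X 0 ^ a * MvPolynomial.X 1 ^ b) : MvPolynomial (Fin 2) ℂ) =
        MvPolynomial.X 0 ^ (a + 2) * MvPolynomial.X 1 ^ b
        - (2 : ℂ) • (MvPolynomial.X 0 ^ (a + 1) * MvPolynomial.X 1 ^ (b + 1))
        + MvPolynomial.X 0 ^ a * MvPolynomial.X 1 ^ (b + 2) := by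
      rw [show (2 : ℂ) = ((2 : ℕ) : ℂ) by norm_num, Nat.cast_smul_eq_nsmul, nsmul_eq_mul]
      push_cast
      ring
    rw [h, map_add, map_sub, map_smul, ofPolynomial_monomial, ofPolynomial_monomial,
      ofPolynomial_monomial, inner_add_left, inner_sub_left, inner_smul_left, inner_mono,
      inner_mono, inner_mono, map_ofNat]
  rw [diagSq, polynomialSubmodule, Submodule.orthogonal_closure, Submodule.mem_orthogonal]
  constructor
  · intro h a b
    rw [← key]
    exact h _ ⟨_, Ideal.mem_span_singleton.2 ⟨_, rfl⟩, rfl⟩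
  · rintro h _ ⟨q, hq, rfl⟩
    obtain ⟨r, rfl⟩ := Ideal.mem_span_singleton.1 hq
    clear hq
    induction r using MvPolynomial.induction_on' with
    | add p q hp hq =>
      rw [mul_add, map_add, inner_add_left, hp, hq, add_zero]
    | monomial u c =>
      rw [MvPolynomial.monomial_eq, Finsupp.prod_fintype _ _ (by simp), Fin.prod_univ_two,
        mul_left_comm, ← MvPolynomial.smul_eq_C_mul, map_smul, inner_smul_left, key, h, mul_zero]

/-- The projection of `z^a w^b` onto the orthogonal complement of `[(z - w)²]`. -/
def affinePart (a b : ℕ) : Hardy :=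
  ∑ c ∈ Finset.range (a + b + 1), (affineProj (a + b) c a : ℂ) • mono (c, a + b - c)

theorem taylorCoeff_affinePart (a b c d : ℕ) :
    taylorCoeff (c, d) (affinePart a b) =
      if c + d = a + b then (affineProj (a + b) c a : ℂ) else 0 := by
  simp only [affinePart, map_sum, map_smul, smul_eq_mul, taylorCoeff_mono, Prod.mk.injEq]
  split_ifs with h
  · rw [Finset.sum_eq_single c]
    · rw [if_pos ⟨rfl, by omega⟩, mul_one]
    · intro e _ hec
      rw [if_neg (fun h => hec h.1.symm), mul_zero]
    · intro hc
      exact absurd (Finset.mem_range.2 (by omega)) hc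
  · refine Finset.sum_eq_zero fun e he => ?_
    have := Finset.mem_range.1 he
    rw [if_neg (by omega), mul_zero]

theorem affine_of_second_diff (n : ℕ) (g : ℕ → ℂ)
    (hg : ∀ a, a + 2 ≤ n → g (a + 2) - 2 * g (a + 1) + g a = 0) (a : ℕ) (ha : a ≤ n) :
    g a = g 0 + (g 1 - g 0) * a := by
  induction a using Nat.twoStepInduction with
  | zero => simp
  | one => simp
  | more a h1 h2 =>
    have h := hg a ha
    rw [h1 (by omega), h2 (by omega)] at h
    push_cast at h ⊢
    linear_combination h

theorem starProjection_mono (a b : ℕ) :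
    diagSq.starProjection (mono (a, b)) = mono (a, b) - affinePart a b := by
  refine Submodule.eq_starProjection_of_mem_orthogonal ?_ ?_
  -- The difference lies in `[(z - w)²]`, being orthogonal to its orthogonal complement.
  · rw [← Submodule.orthogonal_orthogonal diagSq, Submodule.mem_orthogonal']
    intro g hg
    rw [mem_orthogonal_diagSq] at hg
    have hA := affine_of_second_diff (a + b) (fun c => taylorCoeff (c, a + b - c) g) fun c hc => by
      have h := hg c (a + b - (c + 2))
      rwa [show a + b - (c + 2) + 1 = a + b - (c + 1) by omega,
        show a + b - (c + 2) + 2 = a + b - c by omega] at h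
    -- `affineProj` reproduces the affine sequence of the coefficients of `g` in degree `a + b`.
    have hsum : inner ℂ (affinePart a b) g = taylorCoeff (a, b) g := by
      have hab := hA a (by omega)
      rw [Nat.add_sub_cancel_left] at hab
      rw [hab, ← sum_affineProj_mul (a + b) a (by omega), affinePart, sum_inner]
      refine Finset.sum_congr rfl fun c hc => ?_
      have hc' := Finset.mem_range.1 hc
      rw [inner_smul_left, inner_mono, ← hA c (by omega), Complex.conj_ofReal]
      congr 2
      simp only [affineProj]
      ring
    rw [inner_sub_left, hsum, inner_mono, sub_self]
  · rw [sub_sub_cancel, mem_orthogonal_diagSq]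
    intro c d
    simp only [taylorCoeff_affinePart, show c + 1 + (d + 1) = c + 2 + d by ring,
      show c + (d + 2) = c + 2 + d by ring]
    split_ifs
    · simp only [affineProj]
      push_cast
      ring
    · simp

theorem inner_mono_starProjection (a b c d : ℕ) :
    inner ℂ (mono (c, d)) (diagSq.starProjection (mono (a, b))) =
      if c + d = a + b then (projCoeff (a + b) c a : ℂ) else 0 := by
  rw [starProjection_mono, inner_mono, map_sub, taylorCoeff_affinePart, taylorCoeff_mono]
  by_cases h : c + d = a + b
  · have : (c, d) = (a, b) ↔ c = a := by
      rw [Prod.mk.injEq]; omega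
    simp only [h, if_true, projCoeff, this]
    split_ifs <;> simp
  · have : (c, d) ≠ (a, b) := by
      rw [Ne, Prod.mk.injEq]; omega
    simp [h, this]

/-! ### The core operator in the monomial basis -/

theorem adjoint_mulCoord_zero_mono (a b : ℕ) :
    (mulCoord 0).toContinuousLinearMap.adjoint (mono (a, b)) =
      if 1 ≤ a then mono (a - 1, b) else 0 := by
  apply ext_taylorCoeff
  rintro ⟨c, d⟩
  rw [← inner_mono, ContinuousLinearMap.adjoint_inner_right]
  change inner ℂ (mulCoord 0 (mono (c, d))) _ = _
  rw [mulCoord_zero_mono, inner_mono, taylorCoeff_mono]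
  split_ifs <;> simp_all [taylorCoeff_mono] <;> omega

theorem adjoint_mulCoord_one_mono (a b : ℕ) :
    (mulCoord 1).toContinuousLinearMap.adjoint (mono (a, b)) =
      if 1 ≤ b then mono (a, b - 1) else 0 := by
  apply ext_taylorCoeff
  rintro ⟨c, d⟩
  rw [← inner_mono, ContinuousLinearMap.adjoint_inner_right]
  change inner ℂ (mulCoord 1 (mono (c, d))) _ = _
  rw [mulCoord_one_mono, inner_mono, taylorCoeff_mono]
  split_ifs <;> simp_all [taylorCoeff_mono] <;> omega

/-- The core operator is `P - S₀ P S₀* - S₁ P S₁* + S₀ S₁ P S₁* S₀*`, with `P` the projection onto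
`M` and `S₀`, `S₁` the multiplications by the coordinates; written in weak form. -/
theorem inner_coreOperator (M : Submodule ℂ Hardy) [CompleteSpace M] (g f : Hardy) :
    letI P := M.starProjection
    letI R (j : Fin 2) := (mulCoord j).toContinuousLinearMap.adjoint
    inner ℂ g (coreOperator M f) = inner ℂ g (P f) - inner ℂ (R 0 g) (P (R 0 f))
      - inner ℂ (R 1 g) (P (R 1 f)) + inner ℂ (R 1 (R 0 g)) (P (R 1 (R 0 f))) := by
  let P := M.starProjection
  let S (j : Fin 2) : Hardy →L[ℂ] Hardy := (mulCoord j).toContinuousLinearMap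
  have hC : P - S 0 ∘L P ∘L (S 0).adjoint - S 1 ∘L P ∘L (S 1).adjoint +
      S 0 ∘L S 1 ∘L P ∘L (S 1).adjoint ∘L (S 0).adjoint = coreOperator M := by
    refine eq_coreOperator M fun f z => ?_
    have hS (j : Fin 2) (g h : Hardy) : inner ℂ (mulCoord j g) h = inner ℂ g ((S j).adjoint h) :=
      (ContinuousLinearMap.adjoint_inner_right (S j) g h).symm
    rw [integral_coreFunction, hS, hS, hS, hS, inner_kernelAt, inner_kernelAt, inner_kernelAt,
      inner_kernelAt, ← (mulCoord_apply _ z).1, ← (mulCoord_apply _ z).2,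
      ← (mulCoord_apply _ z).2, ← (mulCoord_apply _ z).1]
    have hadd (a b : Hardy) : (a + b) z = a z + b z := map_add (evalCLM z) a b
    have hsub (a b : Hardy) : (a - b) z = a z - b z := map_sub (evalCLM z) a b
    rw [← hsub, ← hsub, ← hadd]
    rfl
  have hS (j : Fin 2) (g h : Hardy) : inner ℂ g (S j h) = inner ℂ ((S j).adjoint g) h :=
    (ContinuousLinearMap.adjoint_inner_left (S j) h g).symm
  rw [← hC]
  simp only [add_apply, sub_apply,
    ContinuousLinearMap.comp_apply, inner_add_right, inner_sub_right, hS]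
  rfl

theorem inner_coreOperator_symm (M : Submodule ℂ Hardy) [CompleteSpace M] (f g : Hardy) :
    inner ℂ (coreOperator M f) g = inner ℂ f (coreOperator M g) := by
  rw [← inner_conj_symm, inner_coreOperator, inner_coreOperator]
  simp only [map_add, map_sub, inner_conj_symm, Submodule.inner_starProjection_left_eq_right]

theorem inner_mono_coreOperator (a b c d : ℕ) :
    inner ℂ (mono (c, d)) (coreOperator diagSq (mono (a, b))) =
      if c + d = a + b then (coreCoeff (a + b) c a : ℂ) else 0 := by
  rw [inner_coreOperator]
  by_cases hdeg : c + d = a + b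
  -- On a common antidiagonal each shifted term survives iff both exponents it lowers are positive.
  · have hd : 1 ≤ d ↔ c < a + b := by omega
    have hb : 1 ≤ b ↔ a < a + b := by omega
    simp only [if_pos hdeg, coreCoeff, ← hd, ← hb]
    by_cases ha1 : 1 ≤ a <;> by_cases hb1 : 1 ≤ b <;> by_cases hc1 : 1 ≤ c <;>
      by_cases hd1 : 1 ≤ d <;>
      simp only [adjoint_mulCoord_zero_mono, adjoint_mulCoord_one_mono, ha1, hb1, hc1, hd1, if_true,
        if_false, map_zero, inner_zero_left, inner_zero_right, inner_mono_starProjection, hdeg,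
        and_true, and_false, sub_zero, add_zero, Complex.ofReal_sub,
        Complex.ofReal_add, show 1 ≤ c → c - 1 + d = a + b - 1 by omega,
        show 1 ≤ d → c + (d - 1) = a + b - 1 by omega,
        show 1 ≤ a → a - 1 + b = a + b - 1 by omega,
        show 1 ≤ b → a + (b - 1) = a + b - 1 by omega,
        show 1 ≤ c → 1 ≤ d → c - 1 + (d - 1) = a + b - 2 by omega,
        show 1 ≤ a → 1 ≤ b → a - 1 + (b - 1) = a + b - 2 by omega]
  · have h1 : 1 ≤ a → 1 ≤ c → c - 1 + d ≠ a - 1 + b := by omega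
    have h2 : 1 ≤ b → 1 ≤ d → c + (d - 1) ≠ a + (b - 1) := by omega
    have h3 : 1 ≤ a → 1 ≤ b → 1 ≤ c → 1 ≤ d → c - 1 + (d - 1) ≠ a - 1 + (b - 1) := by omega
    by_cases ha1 : 1 ≤ a <;> by_cases hb1 : 1 ≤ b <;> by_cases hc1 : 1 ≤ c <;>
      by_cases hd1 : 1 ≤ d <;>
      simp only [adjoint_mulCoord_zero_mono, adjoint_mulCoord_one_mono, ha1, hb1, hc1, hd1, if_true,
        if_false, map_zero, inner_zero_left, inner_zero_right, inner_mono_starProjection, hdeg,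
        sub_zero, add_zero, h1, h2, h3]

theorem norm_coreOperator_mono_sq (a b : ℕ) :
    ‖coreOperator diagSq (mono (a, b))‖ ^ 2 =
      ∑ c ∈ Finset.range (a + b + 1), coreCoeff (a + b) c a ^ 2 := by
  have h := hasSum_norm_inner_sq monoBasis (coreOperator diagSq (mono (a, b)))
  refine h.unique ?_
  simp only [monoBasis_apply]
  rw [← Finset.Nat.sum_antidiagonal_eq_sum_range_succ_mk
    (f := fun p : ℕ × ℕ => coreCoeff (a + b) p.1 a ^ 2)]
  rw [Finset.sum_congr rfl (g := fun p : ℕ × ℕ =>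
    ‖inner ℂ (mono p) (coreOperator diagSq (mono (a, b)))‖ ^ 2)]
  · refine hasSum_sum_of_ne_finset_zero fun p hp => ?_
    rw [Finset.HasAntidiagonal.mem_antidiagonal] at hp
    rw [← Prod.mk.eta (p := p), inner_mono_coreOperator, if_neg hp]
    simp
  · rintro ⟨c, d⟩ hp
    rw [Finset.HasAntidiagonal.mem_antidiagonal] at hp
    rw [inner_mono_coreOperator, if_pos hp]
    simp

theorem hasSum_norm_coreOperator_mono_sq :
    HasSum (fun n : ℕ × ℕ => ‖coreOperator diagSq (mono n)‖ ^ 2) (4 / 3 * Real.pi ^ 2 - 9) := by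
  have hdeg (n : ℕ) : HasSum (fun p : Finset.HasAntidiagonal.antidiagonal n =>
      ‖coreOperator diagSq (mono p)‖ ^ 2) (∑ a ∈ Finset.range (n + 1),
        ∑ b ∈ Finset.range (n + 1), coreCoeff n a b ^ 2) := by
    rw [← Finset.Nat.sum_antidiagonal_eq_sum_range_succ_mk
      (f := fun p : ℕ × ℕ => ∑ b ∈ Finset.range (n + 1), coreCoeff n p.1 b ^ 2),
      ← Finset.sum_coe_sort]
    convert hasSum_fintype _ using 2 with p
    obtain ⟨⟨a, b⟩, hp⟩ := p
    obtain rfl := Finset.HasAntidiagonal.mem_antidiagonal.1 hp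
    rw [norm_coreOperator_mono_sq]
    exact Finset.sum_congr rfl fun c _ => by rw [coreCoeff_symm]
  rw [← Finset.HasAntidiagonal.sigmaAntidiagonalEquivProd.hasSum_iff]
  refine hasSum_sum_coreCoeff_sq.sigma_of_hasSum hdeg ?_
  refine (summable_sigma_of_nonneg fun _ => sq_nonneg _).2 ⟨fun n => (hdeg n).summable, ?_⟩
  exact hasSum_sum_coreCoeff_sq.summable.congr fun n => (hdeg n).tsum_eq.symm

end Bidisk

end

theorem corollary3p1 :
    Bidisk.HasHilbertSchmidtNormSq
        (Bidisk.coreOperator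
          (Bidisk.polynomialSubmodule ((MvPolynomial.X 0 - MvPolynomial.X 1) ^ 2)))
        (4 / 3 * Real.pi ^ 2 - 9) ∧
      Bidisk.HasTrace
        (Bidisk.coreOperator
            (Bidisk.polynomialSubmodule ((MvPolynomial.X 0 - MvPolynomial.X 1) ^ 2)) ∘L
          Bidisk.coreOperator
            (Bidisk.polynomialSubmodule ((MvPolynomial.X 0 - MvPolynomial.X 1) ^ 2)))
        ((4 / 3 * Real.pi ^ 2 - 9 : ℝ) : ℂ) := by
  have hT := Bidisk.inner_coreOperator_symm Bidisk.diagSq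
  have h : Bidisk.HasHilbertSchmidtNormSq (Bidisk.coreOperator Bidisk.diagSq)
      (4 / 3 * Real.pi ^ 2 - 9) :=
    Bidisk.hasHilbertSchmidtNormSq_of_hasSum hT Bidisk.monoBasis
      (Bidisk.hasSum_norm_coreOperator_mono_sq.congr_fun fun n => by rw [Bidisk.monoBasis_apply])
  exact ⟨h, h.hasTrace_comp_self hT⟩
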